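/- Let $n\ge 0$, $\ell\ge 1$, $r\ge 2$ be integers, let $k=\ell r$, and let $\mathbb V=\mathbb F_2^n$ with $\langle u,x\rangle=\sum_i u_ix_i\in\mathbb F_2$. For $m\ge 1$ put $\zeta_{2^m}=e^{2\pi i/2^m}$. A function $g:\mathbb V\to\mathbb Z_{2^m}$ is gbent over $\mathbb Z_{2^m}$ if its Walsh–Hadamard transform $\mathcal W_g(u)=\sum_{x\in\mathbb V}\zeta_{2^m}^{g(x)}(-1)^{\langle u,x\rangle}$ satisfies $|\mathcal W_g(u)|=2^{n/2}$ for all $u\in\mathbb V$. Let $f:\mathbb V\to\mathbb Z_{2^k}$ have the $2^\ell$-adic decomposition $f(x)=\sum_{j=0}^{r-1}2^{j\ell}c_j(x)$ with components $c_j:\mathbb V\to\mathbb Z_{2^\ell}$ (values read as integers in $\{0,\dots,2^\ell-1\}$). For $\alpha=(\alpha_0,\dots,\alpha_{r-2})\in(\mathbb Z_{2^\ell})^{r-1}$ and $u\in\mathbb V$ let $P_\alpha=\{x\in\mathbb V: c_j(x)=\alpha_j \text{ for } 0\le j\le r-2\}$ and $$C_\alpha(u)=\sum_{x\in P_\alpha}\zeta_{2^\ell}^{c_{r-1}(x)}(-1)^{\langle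 u,x\rangle}.$$ Suppose that 1. (common-argument hypothesis) for each $u\in\mathbb V$ there is $\theta\in\mathbb R$ such that every nonzero $C_\alpha(u)$ is of the form $\rho_\alpha e^{i\theta}$ with $\rho_\alpha>0$ real; 2. each lower component $c_0,\dots,c_{r-2}$ is $\mathbb Z_{2^\ell}$-affine, i.e. of the form $x\mapsto a_0+\sum_{i=1}^n a_ix_i$ with $a_0,\dots,a_n\in\mathbb Z_{2^\ell}$ and each $x_i$ read as an element of $\{0,1\}$ (this includes every translate of a group homomorphism $\mathbb V\to\mathbb Z_{2^\ell}$). Then $f$ is gbent over $\mathbb Z_{2^k}$ if and only if all $r-1$ basis functions $c_{r-1}+c_j$, $j=0,\dots,r-2$, are gbent over $\mathbb Z_{2^\ell}$. -/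

import Mathlib

open scoped BigOperators

noncomputable section

namespace GBent

/-- The space `𝔽₂ⁿ`. -/
abbrev V (n : ℕ) : Type := Fin n → ZMod 2

/-- The primitive `2^k`-th root of unity `exp (2πi / 2^k)`. -/
def zeta (k : ℕ) : ℂ := Complex.exp (2 * Real.pi * Complex.I / 2 ^ k)

/-- The sign `(-1)^⟨u, x⟩`, where `⟨u, x⟩ = ∑ uᵢ xᵢ` in `𝔽₂`. -/
def sign {n : ℕ} (u x : V n) : ℂ := (-1) ^ (u ⬝ᵥ x).val

/-- The (unnormalized) Walsh-Hadamard transform of `f : 𝔽₂ⁿ → ℤ/2^k` at `u`. -/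
def walsh {n : ℕ} (k : ℕ) (f : V n → ZMod (2 ^ k)) (u : V n) : ℂ :=
  ∑ x : V n, zeta k ^ (f x).val * sign u x

/-- `f` is generalized bent over `ℤ/2^k`. -/
def IsGBent {n : ℕ} (k : ℕ) (f : V n → ZMod (2 ^ k)) : Prop :=
  ∀ u : V n, ‖walsh k f u‖ = (2 : ℝ) ^ ((n : ℝ) / 2)

/-- `f = c₀ + 2^ℓ c₁ + ⋯ + 2^((r-1)ℓ) c_{r-1}` in `ℤ/2^k`, where elements of `ℤ/2^ℓ` are
identified with their representatives in `{0, …, 2^ℓ - 1}`. -/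
def IsAdicDecomposition {n k ℓ r : ℕ} (f : V n → ZMod (2 ^ k))
    (c : Fin r → V n → ZMod (2 ^ ℓ)) : Prop :=
  ∀ x : V n, f x = ∑ j : Fin r, (2 : ZMod (2 ^ k)) ^ ((j : ℕ) * ℓ) * ((c j x).val : ZMod (2 ^ k))

/-- The lower components `c₀, …, c_{r-2}`. -/
def lower {n ℓ r : ℕ} (c : Fin r → V n → ZMod (2 ^ ℓ)) (j : Fin (r - 1)) :
    V n → ZMod (2 ^ ℓ) :=
  c ⟨j, by omega⟩

/-- The highest component `c_{r-1}`. -/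
def top {n ℓ r : ℕ} (hr : 2 ≤ r) (c : Fin r → V n → ZMod (2 ^ ℓ)) : V n → ZMod (2 ^ ℓ) :=
  c ⟨r - 1, by omega⟩

/-- The cell `P_α` on which `b₀, …, b_{m-1}` take the values `α₀, …, α_{m-1}`. -/
def cell {n ℓ m : ℕ} (b : Fin m → V n → ZMod (2 ^ ℓ)) (α : Fin m → ZMod (2 ^ ℓ)) :
    Finset (V n) :=
  Finset.univ.filter fun x => ∀ j, b j x = α j

/-- The partial Walsh sum `C_α(u)` of `t` over the cell `P_α` of `b₀, …, b_{m-1}`. -/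
def coeff {n ℓ m : ℕ} (b : Fin m → V n → ZMod (2 ^ ℓ)) (t : V n → ZMod (2 ^ ℓ))
    (α : Fin m → ZMod (2 ^ ℓ)) (u : V n) : ℂ :=
  ∑ x ∈ cell b α, zeta ℓ ^ (t x).val * sign u x

/-- A family of complex numbers all of whose members are positive real multiples of one
and the same `exp (iθ)`. -/
def CommonArgument {ι : Type*} (z : ι → ℂ) : Prop :=
  ∃ (θ : ℝ) (ρ : ι → ℝ), ∀ i, 0 < ρ i ∧ z i = (ρ i : ℂ) * Complex.exp (θ * Complex.I)

/-- `b : 𝔽₂ⁿ → ℤ/2^ℓ` is `ℤ/2^ℓ`-affine: `b(x) = a₀ + ∑ aᵢ xᵢ` with all coefficients in `ℤ/2^ℓ`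
and `xᵢ` read as an element of `{0, 1}`. This class contains every translate of an additive
homomorphism, see `isAffine_of_addMonoidHom`. -/
def IsAffine {n ℓ : ℕ} (b : V n → ZMod (2 ^ ℓ)) : Prop :=
  ∃ (a₀ : ZMod (2 ^ ℓ)) (a : Fin n → ZMod (2 ^ ℓ)),
    ∀ x : V n, b x = a₀ + ∑ i, a i * ((x i).val : ZMod (2 ^ ℓ))

theorem isAffine_of_addMonoidHom {n ℓ : ℕ} (φ : V n →+ ZMod (2 ^ ℓ)) (a₀ : ZMod (2 ^ ℓ)) :
    IsAffine fun x => a₀ + φ x := by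
  refine ⟨a₀, fun i => φ (Pi.single i 1), fun x => ?_⟩
  have hx : x = ∑ i, (x i).val • (Pi.single i 1 : V n) := by
    ext j
    rw [Finset.sum_apply, Finset.sum_eq_single j]
    · rw [Pi.smul_apply, Pi.single_eq_same, nsmul_one, ZMod.natCast_zmod_val]
    · intro i _ hij
      rw [Pi.smul_apply, Pi.single_eq_of_ne hij.symm, smul_zero]
    · simp
  have h2 : φ x = ∑ i, (x i).val • φ (Pi.single i 1) := by
    conv_lhs => rw [hx]
    simp only [map_sum, map_nsmul]
  simp only [h2, nsmul_eq_mul, mul_comm]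

end GBent

end

namespace GBent

/-! Distinct cells are disjoint, so by orthogonality of characters `∑ u, C_α(u) * conj C_β(u) = 0`
for `α ≠ β`. A common argument makes every summand a nonnegative real, so each vanishes: at each `u`
at most one `C_α(u)` is nonzero (`coeff_eq_zero_or_of_commonArgument`). The transforms of `f` and of
every `c_{r-1} + c_j` are combinations of the same `C_α(u)` with roots of unity as weights, so at
each `u` they all have the same modulus. -/

theorem zeta_pow_two_pow (k : ℕ) : zeta k ^ 2 ^ k = 1 := by
  rw [zeta, ← Complex.exp_nat_mul, Complex.exp_eq_one_iff]
  refine ⟨1, ?_⟩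
  push_cast
  field_simp

theorem norm_zeta (k : ℕ) : ‖zeta k‖ = 1 :=
  Complex.norm_eq_one_of_pow_eq_one (zeta_pow_two_pow k) (by positivity)

theorem zeta_pow_val_natCast (k m : ℕ) : zeta k ^ ((m : ZMod (2 ^ k))).val = zeta k ^ m := by
  rw [ZMod.val_natCast, ← pow_mod_orderOf (zeta k) m, ← pow_mod_orderOf (zeta k) (m % 2 ^ k),
    Nat.mod_mod_of_dvd _ (orderOf_dvd_of_pow_eq_one (zeta_pow_two_pow k))]

theorem zeta_pow_val_add {k : ℕ} (a b : ZMod (2 ^ k)) :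
    zeta k ^ (a + b).val = zeta k ^ a.val * zeta k ^ b.val := by
  rw [← pow_add, ← zeta_pow_val_natCast k (a.val + b.val)]
  simp only [Nat.cast_add, ZMod.natCast_zmod_val]

theorem zeta_add_pow_two_pow (ℓ d : ℕ) : zeta (d + ℓ) ^ 2 ^ d = zeta ℓ := by
  rw [zeta, zeta, ← Complex.exp_nat_mul]
  congr 1
  push_cast
  rw [pow_add]
  field_simp

theorem sign_eq_prod {n : ℕ} (u x : V n) : sign u x = ∏ i, (-1 : ℂ) ^ (u i * x i).val := by
  have key (a b : ZMod 2) : (-1 : ℂ) ^ (a + b).val = (-1) ^ a.val * (-1) ^ b.val := by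
    rw [← pow_add, ZMod.val_add, ← neg_one_pow_eq_pow_mod_two]
  have gen (s : Finset (Fin n)) :
      (-1 : ℂ) ^ (∑ i ∈ s, u i * x i).val = ∏ i ∈ s, (-1 : ℂ) ^ (u i * x i).val := by
    induction s using Finset.cons_induction with
    | empty => simp
    | cons i s hi ih => rw [Finset.sum_cons, Finset.prod_cons, key, ih]
  exact gen Finset.univ

theorem conj_sign {n : ℕ} (u x : V n) : (starRingEnd ℂ) (sign u x) = sign u x := by
  simp [sign]

/-- Orthogonality of the characters of `𝔽₂ⁿ`. -/
theorem sum_sign_mul_sign_of_ne {n : ℕ} {x y : V n} (h : x ≠ y) :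
    ∑ u : V n, sign u x * sign u y = 0 := by
  have hloc (a b : ZMod 2) (hab : a ≠ b) :
      ∑ t : ZMod 2, (-1 : ℂ) ^ (t * a).val * (-1) ^ (t * b).val = 0 := by
    have h2 : ∀ g : ZMod 2 → ℂ, ∑ t : ZMod 2, g t = g 0 + g 1 := fun g => Fin.sum_univ_two g
    have hval : ZMod.val (1 : ZMod 2) = 1 := rfl
    rw [h2]
    obtain ⟨rfl, rfl⟩ | ⟨rfl, rfl⟩ : a = 0 ∧ b = 1 ∨ a = 1 ∧ b = 0 := by
      revert a b; decide
    all_goals simp [hval]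
  obtain ⟨i, hi⟩ := Function.ne_iff.mp h
  simp only [sign_eq_prod, ← Finset.prod_mul_distrib]
  rw [← Fintype.prod_sum fun (i : Fin n) (t : ZMod 2) =>
    (-1 : ℂ) ^ (t * x i).val * (-1) ^ (t * y i).val]
  exact Finset.prod_eq_zero (Finset.mem_univ i) (hloc _ _ hi)

/-- The partial Walsh sums over two different cells are orthogonal. -/
theorem sum_coeff_mul_conj_coeff_of_ne {n ℓ m : ℕ} (b : Fin m → V n → ZMod (2 ^ ℓ))
    (t : V n → ZMod (2 ^ ℓ)) {α β : Fin m → ZMod (2 ^ ℓ)} (h : α ≠ β) :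
    ∑ u : V n, coeff b t α u * (starRingEnd ℂ) (coeff b t β u) = 0 := by
  simp only [coeff, map_sum, map_mul, conj_sign, Finset.sum_mul_sum]
  rw [Finset.sum_comm]
  refine Finset.sum_eq_zero fun x hx => ?_
  rw [Finset.sum_comm]
  refine Finset.sum_eq_zero fun y hy => ?_
  have hxy : x ≠ y := by
    rintro rfl
    simp only [cell, Finset.mem_filter, Finset.mem_univ, true_and] at hx hy
    exact h (funext fun j => (hx j).symm.trans (hy j))
  simp only [mul_mul_mul_comm _ (sign _ x), ← Finset.mul_sum, sum_sign_mul_sign_of_ne hxy, mul_zero]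

theorem CommonArgument.exists_mul_conj_eq {ι : Type*} {z : ι → ℂ} (h : CommonArgument z)
    (i j : ι) : ∃ s : ℝ, 0 < s ∧ z i * (starRingEnd ℂ) (z j) = s := by
  obtain ⟨θ, ρ, hρ⟩ := h
  refine ⟨ρ i * ρ j, mul_pos (hρ i).1 (hρ j).1, ?_⟩
  have hexp : Complex.exp (θ * Complex.I) * (starRingEnd ℂ) (Complex.exp (θ * Complex.I)) = 1 := by
    rw [Complex.mul_conj, Complex.normSq_eq_norm_sq, Complex.norm_exp_ofReal_mul_I]
    simp
  rw [(hρ i).2, (hρ j).2, map_mul, Complex.conj_ofReal, mul_mul_mul_comm, hexp]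
  push_cast
  ring

/-- If the nonzero partial Walsh sums have a common argument at every point, then at every point
at most one of them is nonzero. -/
theorem coeff_eq_zero_or_of_commonArgument {n ℓ m : ℕ} {b : Fin m → V n → ZMod (2 ^ ℓ)}
    {t : V n → ZMod (2 ^ ℓ)}
    (hcommon : ∀ u : V n, CommonArgument
      (fun α : {α : Fin m → ZMod (2 ^ ℓ) // coeff b t α u ≠ 0} => coeff b t α u))
    {α β : Fin m → ZMod (2 ^ ℓ)} (h : α ≠ β) (u : V n) :
    coeff b t α u = 0 ∨ coeff b t β u = 0 := by
  -- The hypothesis covers only nonzero sums; if either vanishes, `s = 0`.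
  have key (v : V n) : ∃ s : ℝ, 0 ≤ s ∧ coeff b t α v * (starRingEnd ℂ) (coeff b t β v) = s := by
    by_cases hα : coeff b t α v = 0
    · exact ⟨0, le_rfl, by simp [hα]⟩
    by_cases hβ : coeff b t β v = 0
    · exact ⟨0, le_rfl, by simp [hβ]⟩
    obtain ⟨s, hs, h'⟩ := (hcommon v).exists_mul_conj_eq ⟨α, hα⟩ ⟨β, hβ⟩
    exact ⟨s, hs.le, h'⟩
  choose s hs hmul using key
  have hsum : ∑ v, s v = 0 := by
    have := sum_coeff_mul_conj_coeff_of_ne b t h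
    simp only [hmul] at this
    exact_mod_cast this
  have hu := (Finset.sum_eq_zero_iff_of_nonneg fun v _ => hs v).mp hsum u (Finset.mem_univ u)
  have hprod := hmul u
  rw [hu, Complex.ofReal_zero, mul_eq_zero, map_eq_zero] at hprod
  exact hprod

/-- With at most one nonzero term there is no interference, so unimodular weights cannot change the
modulus. -/
theorem norm_sum_mul_eq_of_subsingleton_support {ι : Type*} [Fintype ι] {z : ι → ℂ}
    (hz : ∀ i j, i ≠ j → z i = 0 ∨ z j = 0) {w : ι → ℂ} (hw : ∀ i, ‖w i‖ = 1) :
    ‖∑ i, w i * z i‖ = ‖∑ i, z i‖ := by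
  by_cases h : ∃ i, z i ≠ 0
  · obtain ⟨i, hi⟩ := h
    have hj (j : ι) (hji : j ≠ i) : z j = 0 := (hz j i hji).resolve_right hi
    rw [Fintype.sum_eq_single i fun j hji => by rw [hj j hji, mul_zero],
      Fintype.sum_eq_single i hj, norm_mul, hw, one_mul]
  · push Not at h
    simp [h]

/-- A character sum weighted by a function of the cell is a combination of partial Walsh sums. -/
theorem sum_weight_mul_eq_sum_coeff {n ℓ m : ℕ} (b : Fin m → V n → ZMod (2 ^ ℓ))
    (t : V n → ZMod (2 ^ ℓ)) (w : (Fin m → ZMod (2 ^ ℓ)) → ℂ) (u : V n) :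
    ∑ x : V n, w (fun j => b j x) * zeta ℓ ^ (t x).val * sign u x =
      ∑ α, w α * coeff b t α u := by
  rw [← Finset.sum_fiberwise Finset.univ fun x : V n => fun j => b j x]
  refine Finset.sum_congr rfl fun α _ => ?_
  have hcell : (Finset.univ.filter fun x : V n => (fun j => b j x) = α) = cell b α := by
    ext x
    simp [cell, funext_iff]
  rw [hcell, coeff, Finset.mul_sum]
  refine Finset.sum_congr rfl fun x hx => ?_
  have hα : (fun j => b j x) = α := by
    rw [← hcell] at hx
    exact (Finset.mem_filter.mp hx).2
  rw [hα, mul_assoc]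

theorem walsh_add_lower {n ℓ m : ℕ} (b : Fin m → V n → ZMod (2 ^ ℓ))
    (t : V n → ZMod (2 ^ ℓ)) (j : Fin m) (u : V n) :
    walsh ℓ (fun x => t x + b j x) u = ∑ α, zeta ℓ ^ (α j).val * coeff b t α u := by
  rw [← sum_weight_mul_eq_sum_coeff b t fun α => zeta ℓ ^ (α j).val]
  simp only [walsh, zeta_pow_val_add, mul_comm]

/-- The lower digits are constant on a cell and give a phase; the top digit gives the `ℓ`-level sum
`C_α(u)`. -/
theorem walsh_of_isAdicDecomposition {n k ℓ r : ℕ} (hr : 2 ≤ r) (hk : k = ℓ * r)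
    {f : V n → ZMod (2 ^ k)} {c : Fin r → V n → ZMod (2 ^ ℓ)} (hf : IsAdicDecomposition f c)
    (u : V n) :
    walsh k f u = ∑ α, zeta k ^ (∑ j : Fin (r - 1), 2 ^ ((j : ℕ) * ℓ) * (α j).val) *
      coeff (lower c) (top hr c) α u := by
  rw [← sum_weight_mul_eq_sum_coeff (lower c) (top hr c)
    fun α => zeta k ^ (∑ j : Fin (r - 1), 2 ^ ((j : ℕ) * ℓ) * (α j).val), walsh]
  refine Finset.sum_congr rfl fun x _ => ?_
  congr 1
  obtain ⟨s, rfl⟩ : ∃ s, r = s + 1 := ⟨r - 1, by omega⟩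
  have hcast : f x = ((∑ j : Fin (s + 1), 2 ^ ((j : ℕ) * ℓ) * (c j x).val : ℕ) :
      ZMod (2 ^ k)) := by
    rw [hf x]
    push_cast
    rfl
  -- The top digit has weight `2 ^ (s * ℓ)` and `k = s * ℓ + ℓ`.
  have hζ : zeta k ^ 2 ^ (s * ℓ) = zeta ℓ := by
    rw [← zeta_add_pow_two_pow ℓ (s * ℓ), hk, mul_add, mul_one, mul_comm ℓ s]
  rw [hcast, zeta_pow_val_natCast, Fin.sum_univ_castSucc, pow_add, Fin.val_last, pow_mul, hζ]
  rfl

end GBent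

theorem mainTheorem9 (n k ℓ r : ℕ) (hℓ : 1 ≤ ℓ) (hr : 2 ≤ r) (hk : k = ℓ * r)
    (f : GBent.V n → ZMod (2 ^ k)) (c : Fin r → GBent.V n → ZMod (2 ^ ℓ))
    (hf : GBent.IsAdicDecomposition f c)
    (hcommon : ∀ u : GBent.V n, GBent.CommonArgument
      (fun α : {α : Fin (r - 1) → ZMod (2 ^ ℓ) //
          GBent.coeff (GBent.lower c) (GBent.top hr c) α u ≠ 0} =>
        GBent.coeff (GBent.lower c) (GBent.top hr c) α u))
    (haffine : ∀ j : Fin (r - 1), GBent.IsAffine (GBent.lower c j)) :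
    GBent.IsGBent k f ↔
      ∀ j : Fin (r - 1), GBent.IsGBent ℓ (fun x => GBent.top hr c x + GBent.lower c j x) := by
  have hz (u : GBent.V n) := fun α β (h : α ≠ β) =>
    GBent.coeff_eq_zero_or_of_commonArgument hcommon h u
  have hpow (m e : ℕ) : ‖GBent.zeta m ^ e‖ = 1 := by rw [norm_pow, GBent.norm_zeta, one_pow]
  have hwalsh (u : GBent.V n) (j : Fin (r - 1)) : ‖GBent.walsh k f u‖ =
      ‖GBent.walsh ℓ (fun x => GBent.top hr c x + GBent.lower c j x) u‖ := by
    rw [GBent.walsh_of_isAdicDecomposition hr hk hf,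
      GBent.walsh_add_lower (GBent.lower c) (GBent.top hr c) j,
      GBent.norm_sum_mul_eq_of_subsingleton_support (hz u) fun _ => hpow _ _,
      GBent.norm_sum_mul_eq_of_subsingleton_support (hz u) fun _ => hpow _ _]
  exact ⟨fun h j u => (hwalsh u j).symm.trans (h u),
    -- A single basis function suffices here; the index `0` exists because `2 ≤ r`.
    fun h u => (hwalsh u ⟨0, by omega⟩).trans (h _ u)⟩
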